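/- Let $d$ be an odd prime, $n$ a natural number, and let $s,t\in\mathbb{Z}_d$ satisfy $s^2+t^2\equiv 1 \pmod d$ and be nontrivial, i.e. $s^2,t^2\not\equiv 0,1\pmod d$. On $n$-qudit systems $\mathcal H_A,\mathcal H_B\cong(\mathbb{C}^d)^{\otimes n}$ let $$U_{s,t}=\sum_{\vec i,\vec j\in\mathbb{Z}_d^n}|s\vec i+t\vec j\rangle\langle\vec i|_A\otimes|-t\vec i+s\vec j\rangle\langle\vec j|_B,\qquad \Lambda_{s,\sigma}(\rho)=\mathrm{Tr}_B\big[U_{s,t}(\rho\otimes\sigma)U_{s,t}^\dagger\big].$$ With $\omega=e^{2\pi i/d}$, a Pauli operator is a power of $\omega$ times a tensor product of operators $w(p,q)=\omega^{-2^{-1}pq}Z^pX^q$, where $X|k\rangle=|k+1\rangle$ and $Z|k\rangle=\omega^k|k\rangle$. A stabilizer state is a state of the form $d^{-(n-r)}\prod_{i=1}^r\big(\frac1d\sum_{k=0}^{d-1}g_i^{k}\big)$ with $r\le n$ and $g_1,\dots,g_r$ independent commuting Pauli operators (it is pure iff $r=n$). For a channel $\Lambda$ and an input state $\rho$ with a purification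 $\Psi_{RA}$, let $I_c(\rho,\Lambda)=S(\Lambda(\rho))-S\big((I_R\otimes\Lambda)(|\Psi_{RA}\rangle\langle\Psi_{RA}|)\big)$ with $S$ the von Neumann entropy, let $Q^{(1)}(\Lambda)=\max_\rho I_c(\rho,\Lambda)$, and define the quantum capacity by $Q(\Lambda)=\lim_{N\to\infty}\frac1N Q^{(1)}(\Lambda^{\otimes N})$. If the environmental state $\sigma$ is a convex combination of stabilizer states, then $$Q(\Lambda_{s,\sigma})=0,$$ and moreover $I_c(\rho,\Lambda_{s,\sigma}^{\otimes N})\le 0$ for every $N$ and every input state $\rho$ of $\Lambda_{s,\sigma}^{\otimes N}$. -/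

import Mathlib

open Matrix Filter Topology
open scoped ComplexOrder Kronecker

namespace DiscreteBeamSplitter

noncomputable section

/-! ### Finite-dimensional quantum states, entropy and channels

A system with computational basis indexed by a finite type `A` has Hilbert space `A → ℂ`; operators
on it are matrices `Matrix A A ℂ`, and composite systems are indexed by products. -/

/-- `ρ` is a quantum state (density matrix): positive semidefinite with trace one. -/
def IsState {A : Type*} [Fintype A] (ρ : Matrix A A ℂ) : Prop :=
  ρ.PosSemidef ∧ ρ.trace = 1

/-- Partial trace over the first tensor factor. -/
def ptraceLeft {A B : Type*} [Fintype A] (M : Matrix (A × B) (A × B) ℂ) : Matrix B B ℂ :=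
  Matrix.of fun b b' => ∑ a, M (a, b) (a, b')

/-- Partial trace over the second tensor factor. -/
def ptraceRight {A B : Type*} [Fintype B] (M : Matrix (A × B) (A × B) ℂ) : Matrix A A ℂ :=
  Matrix.of fun a a' => ∑ b, M (a, b) (a', b)

/-- The rank-one operator `|Ψ⟩⟨Ψ|`. -/
def proj {A : Type*} (Ψ : A → ℂ) : Matrix A A ℂ :=
  Matrix.vecMulVec Ψ (star Ψ)

open Classical in
/-- The von Neumann entropy `S(ρ) = -Tr ρ log₂ ρ = -∑ λ log₂ λ` (in bits), the sum running over the
eigenvalues of the Hermitian matrix `ρ` with multiplicity; it is only used for states. -/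
def entropy {A : Type*} [Fintype A] [DecidableEq A] (ρ : Matrix A A ℂ) : ℝ :=
  if h : ρ.IsHermitian then
    ∑ i, Real.negMulLog (h.eigenvalues i) / Real.log 2 else 0

/-- The map `id_R ⊗ Λ` on operators of the composite system `R ⊗ A`: `Λ` is applied to each block
`⟨r| M |r'⟩`. -/
def idTensor (R : Type*) {A B : Type*} (Λ : Matrix A A ℂ →ₗ[ℂ] Matrix B B ℂ)
    (M : Matrix (R × A) (R × A) ℂ) : Matrix (R × B) (R × B) ℂ :=
  Matrix.of fun x y => Λ (Matrix.of fun a a' => M (x.1, a) (y.1, a')) x.2 y.2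

/-- The tensor power `Λ^{⊗ N}`: the linear map that sends each matrix unit
`⨂ₖ |i k⟩⟨j k|` to `⨂ₖ Λ(|i k⟩⟨j k|)`. -/
def tensorPower {A B : Type*} [Fintype A] [DecidableEq A]
    (Λ : Matrix A A ℂ →ₗ[ℂ] Matrix B B ℂ) (N : ℕ) :
    Matrix (Fin N → A) (Fin N → A) ℂ →ₗ[ℂ] Matrix (Fin N → B) (Fin N → B) ℂ where
  toFun ρ := Matrix.of fun x y =>
    ∑ i, ∑ j, ρ i j * ∏ k, Λ (Matrix.single (i k) (j k) 1) (x k) (y k)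
  map_add' ρ τ := by
    ext x y
    simp [add_mul, Finset.sum_add_distrib]
  map_smul' c ρ := by
    ext x y
    simp [Finset.mul_sum, mul_assoc]

/-- The vector `Ψ` of the composite system `R ⊗ A` is a purification of `ρ`:
`Tr_R |Ψ⟩⟨Ψ| = ρ`. -/
def IsPurification {R A : Type*} [Fintype R] (Ψ : R × A → ℂ) (ρ : Matrix A A ℂ) : Prop :=
  ptraceLeft (proj Ψ) = ρ

/-- The coherent information `I_c(ρ, Λ) = S(Λ(ρ)) - S((id_R ⊗ Λ)(|Ψ⟩⟨Ψ|))`, computed with a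
purification `Ψ` of `ρ`. -/
def coherentInfo {R A B : Type*} [Fintype R] [DecidableEq R] [Fintype B] [DecidableEq B]
    (Λ : Matrix A A ℂ →ₗ[ℂ] Matrix B B ℂ) (ρ : Matrix A A ℂ) (Ψ : R × A → ℂ) : ℝ :=
  entropy (Λ ρ) - entropy (idTensor R Λ (proj Ψ))

/-- The set of all values `I_c(ρ, Λ)`, where `ρ` runs over the states of the input system (with any
purification on a finite-dimensional reference system). -/
def coherentInfoValues {A B : Type*} [Fintype A] [Fintype B] [DecidableEq B]
    (Λ : Matrix A A ℂ →ₗ[ℂ] Matrix B B ℂ) : Set ℝ :=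
  {x | ∃ ρ : Matrix A A ℂ, IsState ρ ∧ ∃ (r : ℕ) (Ψ : Fin r × A → ℂ),
    IsPurification Ψ ρ ∧ x = coherentInfo Λ ρ Ψ}

/-- `Q⁽¹⁾(Λ) = q`: the maximum of the coherent information over all input states is attained and
equal to `q`. -/
def HasOneShotCoherentInfo {A B : Type*} [Fintype A] [Fintype B] [DecidableEq B]
    (Λ : Matrix A A ℂ →ₗ[ℂ] Matrix B B ℂ) (q : ℝ) : Prop :=
  IsGreatest (coherentInfoValues Λ) q

/-- `Q(Λ) = Q`: the limit of `Q⁽¹⁾(Λ^{⊗ N}) / N` as `N → ∞` exists and is equal to `Q`. -/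
def HasQuantumCapacity {A B : Type*} [Fintype A] [DecidableEq A] [Fintype B] [DecidableEq B]
    (Λ : Matrix A A ℂ →ₗ[ℂ] Matrix B B ℂ) (Q : ℝ) : Prop :=
  ∃ q : ℕ → ℝ, (∀ N, HasOneShotCoherentInfo (tensorPower Λ N) (q N)) ∧
    Tendsto (fun N : ℕ => q N / (N : ℝ)) atTop (𝓝 Q)

/-! ### Qudits, Weyl operators and stabilizer states -/

/-- Labels of the computational basis of `n` qudits of dimension `d`. -/
abbrev Basis (d n : ℕ) : Type := Fin n → ZMod d

/-- The power `X^q` of the shift operator `X : |k⟩ ↦ |k + 1⟩`. -/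
def shiftX {d : ℕ} (q : ZMod d) : Matrix (ZMod d) (ZMod d) ℂ :=
  Matrix.of fun i j => if i = j + q then 1 else 0

/-- The power `Z^p` of the clock operator `Z : |k⟩ ↦ ω^k |k⟩`, where `ω = exp (2πi / d)`;
`ZMod.stdAddChar k` is `ω^k`. -/
def clockZ {d : ℕ} [NeZero d] (p : ZMod d) : Matrix (ZMod d) (ZMod d) ℂ :=
  Matrix.diagonal fun k => ZMod.stdAddChar (p * k)

/-- The local Weyl operator `w(p, q) = ω^{-2⁻¹ p q} Z^p X^q`. -/
def localWeyl {d : ℕ} [NeZero d] (p q : ZMod d) : Matrix (ZMod d) (ZMod d) ℂ :=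
  (ZMod.stdAddChar (-((2 : ZMod d)⁻¹ * p * q)) : ℂ) • (clockZ p * shiftX q)

/-- The `n`-qudit Weyl operator `w(x) = w(p₁, q₁) ⊗ ⋯ ⊗ w(pₙ, qₙ)` for a phase space point
`x = (p, q)`. -/
def weyl {d n : ℕ} [NeZero d] (x : (Fin n → ZMod d) × (Fin n → ZMod d)) :
    Matrix (Basis d n) (Basis d n) ℂ :=
  Matrix.of fun i j => ∏ k, localWeyl (x.1 k) (x.2 k) (i k) (j k)

/-- The Pauli operator `ω^c w(x)`. -/
def pauli {d n : ℕ} [NeZero d] (c : ZMod d) (x : (Fin n → ZMod d) × (Fin n → ZMod d)) :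
    Matrix (Basis d n) (Basis d n) ℂ :=
  (ZMod.stdAddChar c : ℂ) • weyl x

/-- `ρ` is an `n`-qudit stabilizer state: for some `r ≤ n` there are `r` independent commuting Pauli
operators `g₁, …, g_r` with `ρ = d^{-(n-r)} ∏ᵢ (d⁻¹ ∑_{k=0}^{d-1} gᵢ^k)`. The case `r = n` gives the
pure stabilizer states `|ψ⟩⟨ψ|`, with `gᵢ ψ = ψ` for all `i`; the case `r < n` the mixed ones. -/
def IsStabilizerState {d n : ℕ} [NeZero d] (ρ : Matrix (Basis d n) (Basis d n) ℂ) : Prop :=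
  ∃ (r : ℕ) (c : Fin r → ZMod d) (x : Fin r → (Fin n → ZMod d) × (Fin n → ZMod d)),
    r ≤ n ∧ LinearIndependent (ZMod d) x ∧
    (∀ i j, Commute (pauli (c i) (x i)) (pauli (c j) (x j))) ∧
    ρ = ((d : ℂ) ^ (n - r))⁻¹ •
      (List.ofFn fun i => (d : ℂ)⁻¹ • ∑ k ∈ Finset.range d, pauli (c i) (x i) ^ k).prod

/-! ### The discrete beam splitter -/

/-- The discrete beam splitter
`U_{s,t} = ∑_{i,j} |s i + t j⟩⟨i|_A ⊗ |-t i + s j⟩⟨j|_B` on two `n`-qudit systems. -/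
def beamSplitter {d n : ℕ} [NeZero d] (s t : ZMod d) :
    Matrix (Basis d n × Basis d n) (Basis d n × Basis d n) ℂ :=
  ∑ i : Basis d n, ∑ j : Basis d n,
    Matrix.single (s • i + t • j) i (1 : ℂ) ⊗ₖ Matrix.single (-t • i + s • j) j (1 : ℂ)

/-- The discrete beam splitter channel with environmental state `σ`:
`Λ_{s,σ}(ρ) = Tr_B (U_{s,t} (ρ ⊗ σ) U_{s,t}†)`. -/
def beamSplitterChannel {d n : ℕ} [NeZero d] (s t : ZMod d)
    (σ : Matrix (Basis d n) (Basis d n) ℂ) :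
    Matrix (Basis d n) (Basis d n) ℂ →ₗ[ℂ] Matrix (Basis d n) (Basis d n) ℂ where
  toFun ρ := ptraceRight (beamSplitter s t * (ρ ⊗ₖ σ) * (beamSplitter s t)ᴴ)
  map_add' ρ τ := by
    ext a b
    simp [ptraceRight, Matrix.add_kronecker, Matrix.mul_add, Matrix.add_mul,
      Finset.sum_add_distrib]
  map_smul' c ρ := by
    ext a b
    simp [ptraceRight, Matrix.smul_kronecker, Finset.mul_sum]

end

end DiscreteBeamSplitter

namespace DiscreteBeamSplitter

/-! ### Entropy and the functional calculus -/

section Entropy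

variable {A B R : Type*} [Fintype A] [DecidableEq A] [Fintype B] [DecidableEq B]
  [Fintype R] [DecidableEq R]

/-! With a stabilizer environment the channel is entanglement breaking: it measures its input and
prepares a new state from the outcome. Such maps have nonpositive coherent information, and they are
closed under tensor powers and nonnegative combinations.

For the first claim, write a stabilizer state as a multiple of `∑ a, pauli (c a) (v a)`, where `v`
takes values in an isotropic subgroup of phase space (`prod_average_pauli`). A single environmental
Pauli with label `v` turns `ρ` into `Tr(ρ w(-(s/t) v))` times a Pauli with label `v/t`
(`beamSplitterChannel_pauli`). Rescaling preserves isotropy, so the measured operators commute with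
one another, and so do the prepared ones. A Fourier transform over `(ZMod d)^r` therefore rewrites
the sum as `∑ b, Tr(ρ M_b) τ_b` with `M_b` and `τ_b` positive (`entanglementBreaking_sum_pauli`).

For the second claim, the joint output `M = ∑ X_k ⊗ τ_k` satisfies the reduction inequality `M ≤ 1 ⊗
Tr_R M`. Operator monotonicity of the logarithm then gives `S(Tr_R M) ≤ S(M)`
(`entropy_ptraceLeft_le`). A pure input attains the value zero, so every one-shot maximum, and hence
the capacity, is zero. -/

lemma entropy_of_isHermitian {ρ : Matrix A A ℂ} (h : ρ.IsHermitian) :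
    entropy ρ = ∑ i, Real.negMulLog (h.eigenvalues i) / Real.log 2 := by
  simp [entropy, h]

lemma trace_cfc {ρ : Matrix A A ℂ} (h : ρ.IsHermitian) (f : ℝ → ℝ) :
    (cfc f ρ).trace = ((∑ i, f (h.eigenvalues i) : ℝ) : ℂ) := by
  rw [h.cfc_eq, IsHermitian.cfc, Unitary.conjStarAlgAut_apply, trace_mul_cycle,
    Unitary.coe_star_mul_self, one_mul, trace_diagonal]
  simp

lemma continuousOn_spectrum (ρ : Matrix A A ℂ) (f : ℝ → ℝ) :
    ContinuousOn f (spectrum ℝ ρ) :=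
  (Matrix.finite_real_spectrum (A := ρ)).continuousOn f

lemma trace_mul_cfc {ρ : Matrix A A ℂ} (h : ρ.IsHermitian) (f : ℝ → ℝ) :
    (ρ * cfc f ρ).trace = ((∑ i, h.eigenvalues i * f (h.eigenvalues i) : ℝ) : ℂ) := by
  have h1 : ρ * cfc f ρ = cfc (fun x : ℝ => x * f x) ρ := by
    rw [cfc_mul (fun x : ℝ => x) f ρ (continuousOn_spectrum _ _) (continuousOn_spectrum _ _),
      cfc_id' ℝ ρ h.isSelfAdjoint]
  rw [h1, trace_cfc h]

open scoped MatrixOrder Matrix.Norms.L2Operator in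
lemma exists_conjTranspose_mul_self {X : Matrix A A ℂ} (hX : X.PosSemidef) :
    ∃ C : Matrix A A ℂ, X = Cᴴ * C :=
  CStarAlgebra.nonneg_iff_eq_star_mul_self.1 hX.nonneg

lemma trace_mul_nonneg {X Y : Matrix A A ℂ} (hX : X.PosSemidef) (hY : Y.PosSemidef) :
    0 ≤ (X * Y).trace := by
  obtain ⟨C, rfl⟩ := exists_conjTranspose_mul_self hX
  rw [Matrix.mul_assoc, trace_mul_comm]
  exact (hY.mul_mul_conjTranspose_same C).trace_nonneg

/-- `Y ↦ 1 ⊗ Y` as a star algebra homomorphism. -/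
def oneKronecker (R B : Type*) [Fintype R] [DecidableEq R] [Fintype B] [DecidableEq B] :
    Matrix B B ℂ →⋆ₐ[ℝ] Matrix (R × B) (R × B) ℂ where
  toFun Y := (1 : Matrix R R ℂ) ⊗ₖ Y
  map_one' := by simp
  map_mul' X Y := by rw [← mul_kronecker_mul, one_mul]
  map_zero' := by simp
  map_add' X Y := by rw [kronecker_add]
  commutes' r := by
    rw [Algebra.algebraMap_eq_smul_one, Algebra.algebraMap_eq_smul_one, kronecker_smul,
      one_kronecker_one]
  map_star' X := by
    simp [star_eq_conjTranspose, conjTranspose_kronecker]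

lemma oneKronecker_apply (Y : Matrix B B ℂ) :
    oneKronecker R B Y = (1 : Matrix R R ℂ) ⊗ₖ Y := rfl

lemma one_kronecker_cfc {Y : Matrix B B ℂ} (hY : Y.IsHermitian) (f : ℝ → ℝ) :
    cfc f ((1 : Matrix R R ℂ) ⊗ₖ Y) = (1 : Matrix R R ℂ) ⊗ₖ cfc f Y := by
  have hc : Continuous (oneKronecker R B) :=
    LinearMap.continuous_of_finiteDimensional (oneKronecker R B).toAlgHom.toLinearMap
  have := StarAlgHom.map_cfc (oneKronecker R B) f Y (continuousOn_spectrum _ _) hc hY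
    (hY.isSelfAdjoint.map _)
  rw [oneKronecker_apply, oneKronecker_apply] at this
  exact this.symm

lemma trace_mul_one_kronecker (M : Matrix (R × B) (R × B) ℂ) (Y : Matrix B B ℂ) :
    (M * ((1 : Matrix R R ℂ) ⊗ₖ Y)).trace = (ptraceLeft M * Y).trace := by
  simp only [trace, diag_apply, mul_apply, ptraceLeft, of_apply, Fintype.sum_prod_type,
    kroneckerMap_apply, one_apply, ite_mul, one_mul, zero_mul, mul_ite, mul_zero,
    Finset.sum_mul]
  rw [Finset.sum_comm]
  refine Finset.sum_congr rfl fun b _ => ?_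
  rw [Finset.sum_comm]
  simp only [Finset.sum_comm (s := (Finset.univ : Finset R)) (t := (Finset.univ : Finset B))]
  rw [Finset.sum_comm]
  simp only [Finset.sum_ite_eq, Finset.mem_univ, if_true]
  exact Finset.sum_comm

open scoped MatrixOrder Matrix.Norms.L2Operator in
-- The logarithm is operator monotone on strictly positive operators. The shift by `ε` makes
-- singular `X` and `Y` strictly positive, which avoids the convention `Real.log 0 = 0`.
lemma cfc_log_add_mono {X Y : Matrix A A ℂ} (hX : X.PosSemidef) (hY : Y.PosSemidef)
    (hXY : (Y - X).PosSemidef) {ε : ℝ} (hε : 0 < ε) :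
    (cfc (fun x : ℝ => Real.log (x + ε)) Y - cfc (fun x : ℝ => Real.log (x + ε)) X).PosSemidef := by
  have key : ∀ Z : Matrix A A ℂ, Z.PosSemidef →
      cfc (fun x : ℝ => Real.log (x + ε)) Z = CFC.log (Z + algebraMap ℝ _ ε) := by
    intro Z hZ
    have hZ' : IsSelfAdjoint Z := hZ.1
    have h1 : Z + algebraMap ℝ _ ε = cfc (fun x : ℝ => x + ε) Z := by
      rw [cfc_add_const ε (fun x : ℝ => x) Z, cfc_id' ℝ Z]
    rw [h1, CFC.log, ← cfc_comp' Real.log (fun x : ℝ => x + ε) Z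
      (((Matrix.finite_real_spectrum (A := Z)).image _).continuousOn _)]
  rw [key X hX, key Y hY, ← Matrix.le_iff]
  refine CFC.log_le_log (add_le_add_left (Matrix.le_iff.2 hXY) _) ?_
  rw [Matrix.isStrictlyPositive_iff_posDef, Algebra.algebraMap_eq_smul_one]
  refine Matrix.PosDef.posSemidef_add hX ?_
  exact Matrix.PosDef.one.smul hε

/-- Removes the regularization by `ε`; at `x = 0` the prefactor kills the divergent logarithm. -/
lemma tendsto_mul_log_add {x : ℝ} (hx : 0 ≤ x) :
    Tendsto (fun ε : ℝ => x * Real.log (x + ε)) (𝓝[>] 0) (𝓝 (x * Real.log x)) := by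
  rcases hx.eq_or_lt with rfl | hx
  · simp
  · have h : ContinuousAt (fun ε : ℝ => x * Real.log (x + ε)) 0 := by
      have : x + 0 ≠ 0 := by simpa using hx.ne'
      fun_prop (disch := assumption)
    simpa using h.tendsto.mono_left nhdsWithin_le_nhds

/-- A positive operator on `R ⊗ B` that is dominated by `1 ⊗ Tr_R M` has at least the entropy of its
marginal. -/
lemma entropy_ptraceLeft_le {M : Matrix (R × B) (R × B) ℂ} (hM : M.PosSemidef)
    (hP : (ptraceLeft M).PosSemidef)
    (hle : ((1 : Matrix R R ℂ) ⊗ₖ ptraceLeft M - M).PosSemidef) :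
    entropy (ptraceLeft M) ≤ entropy M := by
  have hlim : ∀ {C : Type _} [Fintype C] [DecidableEq C] {X : Matrix C C ℂ} (hX : X.PosSemidef),
      Tendsto (fun ε : ℝ => ∑ i, hX.1.eigenvalues i * Real.log (hX.1.eigenvalues i + ε)) (𝓝[>] 0)
        (𝓝 (∑ i, hX.1.eigenvalues i * Real.log (hX.1.eigenvalues i))) := fun hX =>
    tendsto_finsetSum _ fun i _ => tendsto_mul_log_add (hX.eigenvalues_nonneg i)
  have hlim' :
      Tendsto (fun ε : ℝ => ∑ i, hP.1.eigenvalues i * Real.log (hP.1.eigenvalues i + ε)) (𝓝[>] 0)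
        (𝓝 (∑ i, hP.1.eigenvalues i * Real.log (hP.1.eigenvalues i))) :=
    tendsto_finsetSum _ fun i _ => tendsto_mul_log_add (hP.eigenvalues_nonneg i)
  have hmain : ∑ i, hM.1.eigenvalues i * Real.log (hM.1.eigenvalues i) ≤
      ∑ i, hP.1.eigenvalues i * Real.log (hP.1.eigenvalues i) := by
    refine le_of_tendsto_of_tendsto (hlim hM) hlim' ?_
    filter_upwards [self_mem_nhdsWithin] with ε hε
    have h1P : ((1 : Matrix R R ℂ) ⊗ₖ ptraceLeft M).PosSemidef := Matrix.PosSemidef.one.kronecker hP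
    -- The quantity `Tr M (log(1 ⊗ Tr_R M + ε) - log(M + ε))` is nonnegative, and its first term
    -- depends only on the marginal of `M`.
    have h := trace_mul_nonneg hM (cfc_log_add_mono hM h1P hle hε)
    rw [one_kronecker_cfc hP.1, mul_sub, trace_sub, trace_mul_one_kronecker, trace_mul_cfc hM.1,
      trace_mul_cfc hP.1, ← Complex.ofReal_sub, Complex.zero_le_real] at h
    linarith
  rw [entropy_of_isHermitian hM.1, entropy_of_isHermitian hP.1, ← Finset.sum_div,
    ← Finset.sum_div]
  gcongr ?_ / _
  simpa [Real.negMulLog] using hmain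

/-- Eigenvalues are indexed differently for the two matrices, so they are compared as the multiset
of roots of the common characteristic polynomial. -/
lemma entropy_reindex (e : A ≃ B) (ρ : Matrix A A ℂ) :
    entropy (ρ.submatrix e.symm e.symm) = entropy ρ := by
  by_cases h : ρ.IsHermitian
  · have h' : (ρ.submatrix e.symm e.symm).IsHermitian := h.submatrix _
    have hc : (ρ.submatrix e.symm e.symm).charpoly = ρ.charpoly :=
      Matrix.charpoly_reindex e ρ
    have hr := h.roots_charpoly_eq_eigenvalues
    rw [← hc, h'.roots_charpoly_eq_eigenvalues] at hr
    have := congrArg (fun m : Multiset ℂ =>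
      (m.map fun z => Real.negMulLog z.re / Real.log 2).sum) hr
    rw [entropy_of_isHermitian h, entropy_of_isHermitian h']
    simpa using this
  · have h' : ¬ (ρ.submatrix e.symm e.symm).IsHermitian := fun h' => h (by
      simpa using h'.submatrix e)
    simp [entropy, h, h']

end Entropy

/-! ### Entanglement-breaking maps -/

/-- `Λ` is entanglement breaking: it has a measure-and-prepare form `ρ ↦ ∑ₖ Tr(ρ Mₖ) τₖ` with positive
operators `Mₖ` and `τₖ`. -/
def EntanglementBreaking {A B : Type*} [Fintype A]
    (Λ : Matrix A A ℂ →ₗ[ℂ] Matrix B B ℂ) : Prop :=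
  ∃ (K : Type) (_ : Fintype K) (M : K → Matrix A A ℂ) (τ : K → Matrix B B ℂ),
    (∀ k, (M k).PosSemidef) ∧ (∀ k, (τ k).PosSemidef) ∧
      ∀ ρ, Λ ρ = ∑ k, (ρ * M k).trace • τ k

namespace EntanglementBreaking

variable {A B : Type*} [Fintype A] {Λ Λ' : Matrix A A ℂ →ₗ[ℂ] Matrix B B ℂ}

lemma add (h : EntanglementBreaking Λ) (h' : EntanglementBreaking Λ') :
    EntanglementBreaking (Λ + Λ') := by
  obtain ⟨K, _, M, τ, hM, hτ, hΛ⟩ := h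
  obtain ⟨K', _, M', τ', hM', hτ', hΛ'⟩ := h'
  refine ⟨K ⊕ K', inferInstance, Sum.elim M M', Sum.elim τ τ', ?_, ?_, fun ρ => ?_⟩
  · rintro (k | k)
    exacts [hM k, hM' k]
  · rintro (k | k)
    exacts [hτ k, hτ' k]
  · simp [hΛ, hΛ']

lemma smul {c : ℝ} (hc : 0 ≤ c) (h : EntanglementBreaking Λ) :
    EntanglementBreaking ((c : ℂ) • Λ) := by
  obtain ⟨K, _, M, τ, hM, hτ, hΛ⟩ := h
  refine ⟨K, inferInstance, M, fun k => (c : ℂ) • τ k, hM, fun k => ?_, fun ρ => ?_⟩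
  · exact (hτ k).smul (by exact_mod_cast hc)
  · simp [hΛ, Finset.smul_sum, smul_comm (c : ℂ)]

end EntanglementBreaking

/-! ### Tensor powers and coherent information of entanglement-breaking maps -/

section

variable {A B R : Type*} [Fintype A] [DecidableEq A] [Fintype R] [DecidableEq R]

/-- A tensor product of Gram matrices `Cᴴ * C` is the Gram matrix of the tensor product of the `C
k`. -/
lemma posSemidef_prod {N : ℕ} {M : Fin N → Matrix A A ℂ} (hM : ∀ k, (M k).PosSemidef) :
    (Matrix.of fun i j : Fin N → A => ∏ k, M k (i k) (j k)).PosSemidef := by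
  choose C hC using fun k => exists_conjTranspose_mul_self (hM k)
  have : (Matrix.of fun i j : Fin N → A => ∏ k, M k (i k) (j k)) =
      (Matrix.of fun i j : Fin N → A => ∏ k, C k (i k) (j k))ᴴ *
        (Matrix.of fun i j : Fin N → A => ∏ k, C k (i k) (j k)) := by
    ext i j
    have h : ∀ k, M k (i k) (j k) = ∑ a, star (C k a (i k)) * C k a (j k) := fun k => by
      conv_lhs => rw [hC k]
      simp [mul_apply]
    simp only [of_apply, h, Finset.prod_univ_sum, Fintype.piFinset_univ, mul_apply,
      conjTranspose_apply, star_prod, Finset.prod_mul_distrib]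
  rw [this]
  exact posSemidef_conjTranspose_mul_self _

/-- Measure the factors independently: outcomes are tuples in `K^N`, with product measurement
operators and product preparations. -/
lemma EntanglementBreaking.tensorPower {Λ : Matrix A A ℂ →ₗ[ℂ] Matrix B B ℂ} [Fintype B]
    [DecidableEq B] (h : EntanglementBreaking Λ) (N : ℕ) :
    EntanglementBreaking (tensorPower Λ N) := by
  obtain ⟨K, _, M, τ, hM, hτ, hΛ⟩ := h
  refine ⟨Fin N → K, inferInstance, fun κ => Matrix.of fun i j => ∏ k, M (κ k) (i k) (j k),
    fun κ => Matrix.of fun i j => ∏ k, τ (κ k) (i k) (j k),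
    fun κ => posSemidef_prod fun k => hM _, fun κ => posSemidef_prod fun k => hτ _, fun ρ => ?_⟩
  ext x y
  have h : ∀ i j k, Λ (Matrix.single i j 1) (x k) (y k) = ∑ κ, M κ j i * τ κ (x k) (y k) := by
    intro i j k
    simp [hΛ, Matrix.sum_apply, trace_single_mul]
  simp only [DiscreteBeamSplitter.tensorPower, LinearMap.coe_mk, AddHom.coe_mk, of_apply, h,
    Finset.prod_univ_sum, Fintype.piFinset_univ, Matrix.sum_apply, Matrix.smul_apply, smul_eq_mul, trace,
    diag_apply, mul_apply, Finset.sum_mul, Finset.mul_sum, Finset.prod_mul_distrib]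
  rw [Finset.sum_comm_cycle]
  simp only [mul_assoc]

/-- Each eigenvalue of a positive operator is at most the sum of all of them. -/
lemma posSemidef_trace_smul_one_sub {X : Matrix R R ℂ} (hX : X.PosSemidef) :
    (X.trace • (1 : Matrix R R ℂ) - X).PosSemidef := by
  set U : Matrix R R ℂ := (hX.1.eigenvectorUnitary).1
  have hU : U * Uᴴ = 1 := Unitary.coe_mul_star_self hX.1.eigenvectorUnitary
  have h : X.trace • (1 : Matrix R R ℂ) - X = U * diagonal (fun i =>
      ((∑ j, hX.1.eigenvalues j - hX.1.eigenvalues i : ℝ) : ℂ)) * Uᴴ := by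
    have h2 : diagonal (fun i => ((∑ j, hX.1.eigenvalues j - hX.1.eigenvalues i : ℝ) : ℂ)) =
        X.trace • (1 : Matrix R R ℂ) - diagonal (RCLike.ofReal ∘ hX.1.eigenvalues) := by
      rw [hX.1.trace_eq_sum_eigenvalues, smul_one_eq_diagonal]
      ext i j
      rcases eq_or_ne i j with rfl | hij
      · simp
      · simp [hij]
    have hs : U * diagonal (RCLike.ofReal ∘ hX.1.eigenvalues) * Uᴴ = X := by
      have := hX.1.spectral_theorem
      rw [Unitary.conjStarAlgAut_apply] at this
      exact this.symm
    rw [h2, Matrix.mul_sub, Matrix.sub_mul, Matrix.mul_smul, Matrix.smul_mul, Matrix.mul_one, hU,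
      hs]
  rw [h]
  refine (PosSemidef.diagonal fun i => ?_).mul_mul_conjTranspose_same U
  rw [Pi.zero_apply, Complex.zero_le_real, sub_nonneg]
  exact Finset.single_le_sum (f := hX.1.eigenvalues) (fun j _ => hX.eigenvalues_nonneg j)
    (Finset.mem_univ i)

lemma ptraceLeft_idTensor (Λ : Matrix A A ℂ →ₗ[ℂ] Matrix B B ℂ) (M : Matrix (R × A) (R × A) ℂ) :
    ptraceLeft (idTensor R Λ M) = Λ (ptraceLeft M) := by
  have h : ptraceLeft M = ∑ r, Matrix.of fun a a' => M (r, a) (r, a') := by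
    ext a a'
    simp [ptraceLeft, Matrix.sum_apply]
  rw [h, map_sum]
  ext b b'
  simp [ptraceLeft, idTensor, Matrix.sum_apply]

/-- This is the unnormalized state of the reference given the outcome `M`. With `M = Cᴴ * C` it is
the Gram matrix of the vectors obtained by applying `C` to the blocks of `Ψ`. -/
lemma posSemidef_of_trace_block_mul (Ψ : R × A → ℂ) {M : Matrix A A ℂ} (hM : M.PosSemidef) :
    (Matrix.of fun r r' =>
      ((Matrix.of fun a a' => proj Ψ (r, a) (r', a')) * M).trace).PosSemidef := by
  obtain ⟨C, rfl⟩ := exists_conjTranspose_mul_self hM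
  have : (Matrix.of fun r r' =>
      ((Matrix.of fun a a' => proj Ψ (r, a) (r', a')) * (Cᴴ * C)).trace) =
      (Matrix.of fun r c => ∑ a, C c a * Ψ (r, a)) *
        (Matrix.of fun r c => ∑ a, C c a * Ψ (r, a))ᴴ := by
    ext r r'
    change (vecMulVec (fun a => Ψ (r, a)) (star fun a => Ψ (r', a)) * (Cᴴ * C)).trace =
      (C *ᵥ fun a => Ψ (r, a)) ⬝ᵥ star (C *ᵥ fun a => Ψ (r', a))
    rw [vecMulVec_mul, trace_vecMulVec, ← vecMul_vecMul, ← star_mulVec, dotProduct_comm,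
      ← dotProduct_mulVec, dotProduct_comm]
  rw [this]
  exact posSemidef_self_mul_conjTranspose _

/-- An entanglement-breaking map has nonpositive coherent information. -/
lemma EntanglementBreaking.coherentInfo_nonpos [Fintype B] [DecidableEq B]
    {Λ : Matrix A A ℂ →ₗ[ℂ] Matrix B B ℂ} (h : EntanglementBreaking Λ) {ρ : Matrix A A ℂ}
    {Ψ : R × A → ℂ} (hΨ : IsPurification Ψ ρ) : coherentInfo Λ ρ Ψ ≤ 0 := by
  obtain ⟨K, _, M, τ, hM, hτ, hΛ⟩ := h
  set X : K → Matrix R R ℂ := fun k => Matrix.of fun r r' =>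
    ((Matrix.of fun a a' => proj Ψ (r, a) (r', a')) * M k).trace with hXdef
  have hX : ∀ k, (X k).PosSemidef := fun k => posSemidef_of_trace_block_mul Ψ (hM k)
  have hout : idTensor R Λ (proj Ψ) = ∑ k, X k ⊗ₖ τ k := by
    ext ⟨r, b⟩ ⟨r', b'⟩
    simp [idTensor, hΛ, Matrix.sum_apply, hXdef]
  have hmarg : ptraceLeft (idTensor R Λ (proj Ψ)) = ∑ k, (X k).trace • τ k := by
    rw [hout]
    ext b b'
    simp only [ptraceLeft, Matrix.sum_apply, kroneckerMap_apply, of_apply, Matrix.smul_apply, trace,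
      diag_apply, smul_eq_mul, Finset.sum_mul]
    exact Finset.sum_comm
  rw [IsPurification] at hΨ
  rw [coherentInfo, sub_nonpos, ← hΨ, ← ptraceLeft_idTensor]
  refine entropy_ptraceLeft_le ?_ ?_ ?_
  · rw [hout]
    exact posSemidef_sum _ fun k _ => (hX k).kronecker (hτ k)
  · rw [hmarg]
    exact posSemidef_sum _ fun k _ => (hτ k).smul (hX k).trace_nonneg
  -- The reduction inequality holds term by term, from `X_k ≤ Tr(X_k) 1`.
  · have : (1 : Matrix R R ℂ) ⊗ₖ ptraceLeft (idTensor R Λ (proj Ψ)) - idTensor R Λ (proj Ψ) =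
        ∑ k, ((X k).trace • (1 : Matrix R R ℂ) - X k) ⊗ₖ τ k := by
      rw [hmarg, hout]
      ext ⟨r, b⟩ ⟨r', b'⟩
      simp only [Matrix.sub_apply, Matrix.sum_apply, kroneckerMap_apply, Matrix.smul_apply, smul_eq_mul,
        Finset.mul_sum, ← Finset.sum_sub_distrib]
      exact Finset.sum_congr rfl fun k _ => by ring
    rw [this]
    exact posSemidef_sum _ fun k _ => (posSemidef_trace_smul_one_sub (hX k)).kronecker (hτ k)

/-- A pure input state has coherent information zero. -/
lemma zero_mem_coherentInfoValues [Nonempty A] [Fintype B] [DecidableEq B]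
    (Λ : Matrix A A ℂ →ₗ[ℂ] Matrix B B ℂ) : 0 ∈ coherentInfoValues Λ := by
  obtain ⟨a⟩ := ‹Nonempty A›
  refine ⟨proj (Pi.single a 1), ⟨posSemidef_vecMulVec_self_star _, ?_⟩, 1,
    fun x => (Pi.single a 1 : A → ℂ) x.2, ?_, ?_⟩
  · simp [proj, trace_vecMulVec]
  · ext i j
    simp only [ptraceLeft, of_apply, Fin.sum_univ_one]
    rfl
  -- The reference is one-dimensional, so both entropies are those of the same matrix up to
  -- relabelling.
  · have : idTensor (Fin 1) Λ (proj fun x => (Pi.single a 1 : A → ℂ) x.2) =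
        (Λ (proj (Pi.single a 1))).submatrix (Equiv.uniqueProd B (Fin 1)).symm.symm
          (Equiv.uniqueProd B (Fin 1)).symm.symm := by
      ext x y
      rfl
    rw [coherentInfo, this, entropy_reindex, sub_self]

lemma EntanglementBreaking.hasQuantumCapacity_zero [Nonempty A] [Fintype B] [DecidableEq B]
    {Λ : Matrix A A ℂ →ₗ[ℂ] Matrix B B ℂ} (h : EntanglementBreaking Λ) :
    HasQuantumCapacity Λ 0 := by
  refine ⟨fun _ => 0, fun N => ⟨zero_mem_coherentInfoValues _, ?_⟩, by simp⟩
  rintro _ ⟨ρ, -, r, Ψ, hΨ, rfl⟩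
  exact (h.tensorPower N).coherentInfo_nonpos hΨ

end

/-! ### Weyl and Pauli operators -/

section Weyl

variable {d n : ℕ} [NeZero d]

/-- The character `k ↦ ω^k`. -/
local notation "χ" => (ZMod.stdAddChar : AddChar (ZMod d) ℂ)

lemma stdAddChar_sum {ι : Type*} (s : Finset ι) (f : ι → ZMod d) :
    χ (∑ i ∈ s, f i) = ∏ i ∈ s, χ (f i) := by
  classical
  induction s using Finset.induction_on with
  | empty => simp
  | insert i s hi ih => rw [Finset.sum_insert hi, Finset.prod_insert hi, AddChar.map_add_eq_mul, ih]

lemma weyl_apply (x : (Fin n → ZMod d) × (Fin n → ZMod d)) (i j : Basis d n) :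
    weyl x i j = if i = j + x.2 then χ (-(2⁻¹ * (x.1 ⬝ᵥ x.2)) + x.1 ⬝ᵥ i) else 0 := by
  have h : ∀ k, localWeyl (x.1 k) (x.2 k) (i k) (j k) =
      if i k = j k + x.2 k then χ (-(2⁻¹ * (x.1 k * x.2 k)) + x.1 k * i k) else 0 := by
    intro k
    simp only [localWeyl, clockZ, shiftX, Matrix.smul_apply, diagonal_mul, of_apply, smul_eq_mul]
    split_ifs
    · rw [mul_one, AddChar.map_add_eq_mul, mul_assoc (2⁻¹ : ZMod d)]
    · simp
  simp only [weyl, of_apply, h]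
  split_ifs with hij
  · have hij' : ∀ k, i k = j k + x.2 k := congrFun hij
    simp only [if_pos (hij' _), ← stdAddChar_sum]
    simp [dotProduct, Finset.sum_add_distrib, Finset.mul_sum]
  · obtain ⟨k, hk⟩ := Function.ne_iff.1 hij
    exact Finset.prod_eq_zero (Finset.mem_univ k) (if_neg hk)

lemma pauli_apply (c : ZMod d) (x : (Fin n → ZMod d) × (Fin n → ZMod d)) (i j : Basis d n) :
    pauli c x i j = if i = j + x.2 then χ (c - 2⁻¹ * (x.1 ⬝ᵥ x.2) + x.1 ⬝ᵥ i) else 0 := by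
  rw [pauli, Matrix.smul_apply, weyl_apply, smul_eq_mul, mul_ite, mul_zero,
    ← AddChar.map_add_eq_mul]
  congr 2
  ring

lemma pauli_zero : pauli (0 : ZMod d) (0 : (Fin n → ZMod d) × (Fin n → ZMod d)) = 1 := by
  ext i j
  simp [pauli_apply, one_apply]

lemma pauli_conjTranspose (c : ZMod d) (x : (Fin n → ZMod d) × (Fin n → ZMod d))
    (h2 : (2 : ZMod d)⁻¹ + 2⁻¹ = 1) :
    (pauli c x)ᴴ = pauli (-c) (-x) := by
  ext i j
  rw [conjTranspose_apply, pauli_apply, pauli_apply]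
  have h : (j = i + x.2) ↔ (i = j + (-x).2) := by
    rw [Prod.snd_neg, ← sub_eq_add_neg, eq_sub_iff_add_eq, eq_comm]
  by_cases hij : j = i + x.2
  · rw [if_pos hij, if_pos (h.1 hij), hij]
    have : star (χ (c - 2⁻¹ * (x.1 ⬝ᵥ x.2) + x.1 ⬝ᵥ (i + x.2))) =
        χ (-(c - 2⁻¹ * (x.1 ⬝ᵥ x.2) + x.1 ⬝ᵥ (i + x.2))) := (AddChar.map_neg_eq_conj _ _).symm
    rw [this]
    congr 1
    simp only [Prod.fst_neg, Prod.snd_neg, neg_dotProduct, dotProduct_neg, dotProduct_add]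
    linear_combination (x.1 ⬝ᵥ x.2) * h2
  · rw [if_neg hij, if_neg (fun h' => hij (h.2 h')), star_zero]

/-- The factor `ω^{-pq/2}` makes the cocycle half the symplectic form, so it vanishes on isotropic
subgroups. The hypothesis `h2` says that `2⁻¹` really is a half. -/
lemma pauli_mul (c c' : ZMod d) (x y : (Fin n → ZMod d) × (Fin n → ZMod d))
    (h2 : (2 : ZMod d)⁻¹ + 2⁻¹ = 1) :
    pauli c x * pauli c' y =
      pauli (c + c' + 2⁻¹ * (x.1 ⬝ᵥ y.2 - y.1 ⬝ᵥ x.2)) (x + y) := by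
  ext i j
  rw [mul_apply, Finset.sum_eq_single (j + y.2)]
  · rw [pauli_apply, pauli_apply, pauli_apply, if_pos rfl]
    have h : i = j + y.2 + x.2 ↔ i = j + (x + y).2 := by
      rw [Prod.snd_add, add_assoc, add_comm y.2]
    by_cases hij : i = j + y.2 + x.2
    · rw [if_pos hij, if_pos (h.1 hij), ← AddChar.map_add_eq_mul, hij]
      congr 1
      simp only [Prod.fst_add, Prod.snd_add, add_dotProduct, dotProduct_add]
      linear_combination (y.1 ⬝ᵥ x.2) * h2
    · rw [if_neg hij, if_neg (fun h' => hij (h.2 h')), zero_mul]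
  · intro m _ hm
    rw [pauli_apply c' y, if_neg hm, mul_zero]
  · simp

/-- Commuting Pauli operators have symplectically orthogonal labels. -/
lemma dotProduct_comm_of_commute {c c' : ZMod d} {x y : (Fin n → ZMod d) × (Fin n → ZMod d)}
    (h2 : (2 : ZMod d)⁻¹ + 2⁻¹ = 1) (h : Commute (pauli c x) (pauli c' y)) :
    x.1 ⬝ᵥ y.2 = y.1 ⬝ᵥ x.2 := by
  have h' := h.eq
  rw [pauli_mul _ _ _ _ h2, pauli_mul _ _ _ _ h2, add_comm y x] at h'
  -- Both products are supported on the same shift; this entry is nonzero and compares their phases.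
  have h'' := congrFun (congrFun h' (x + y).2) 0
  rw [pauli_apply, pauli_apply, if_pos (zero_add _).symm, if_pos (zero_add _).symm] at h''
  have := ZMod.injective_stdAddChar h''
  linear_combination this + (y.1 ⬝ᵥ x.2 - x.1 ⬝ᵥ y.2) * h2

/-- The image of `v` is isotropic for the symplectic form on phase space. -/
def IsIsotropic {G : Type*} [AddCommGroup G]
    (v : G →+ (Fin n → ZMod d) × (Fin n → ZMod d)) : Prop :=
  ∀ a b, (v a).1 ⬝ᵥ (v b).2 = (v b).1 ⬝ᵥ (v a).2

/-- The average of a representation of a finite abelian group by Pauli operators is positive. -/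
lemma posSemidef_sum_pauli {G : Type*} [AddCommGroup G] [Fintype G]
    (h2 : (2 : ZMod d)⁻¹ + 2⁻¹ = 1) (c : G →+ ZMod d)
    {v : G →+ (Fin n → ZMod d) × (Fin n → ZMod d)} (hv : IsIsotropic v) :
    (∑ a, pauli (c a) (v a)).PosSemidef := by
  set P := ∑ a, pauli (c a) (v a) with hP
  have hmul : ∀ a b, pauli (c a) (v a) * pauli (c b) (v b) = pauli (c (a + b)) (v (a + b)) := by
    intro a b
    rw [pauli_mul _ _ _ _ h2, hv a b, sub_self, mul_zero, add_zero, map_add, map_add]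
  have hH : Pᴴ = P := by
    rw [hP, conjTranspose_sum]
    refine Fintype.sum_equiv (Equiv.neg G) _ _ fun a => ?_
    rw [pauli_conjTranspose _ _ h2, Equiv.neg_apply, map_neg, map_neg]
  -- The `pauli (c a) (v a)` represent `G`, so `P` is `|G|` times a projection.
  have hPP : Pᴴ * P = (Fintype.card G : ℝ) • P := by
    rw [hH, hP, Finset.sum_mul_sum]
    have : ∀ a, ∑ b, pauli (c a) (v a) * pauli (c b) (v b) = P := fun a => by
      simp only [hmul]
      exact Fintype.sum_equiv (Equiv.addLeft a) _ _ fun b => rfl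
    rw [Finset.sum_congr rfl fun a _ => this a, Finset.sum_const, Finset.card_univ,
      ← Nat.cast_smul_eq_nsmul ℝ]
  have hc : (Fintype.card G : ℝ) ≠ 0 := by
    exact_mod_cast Fintype.card_ne_zero
  have : P = (Fintype.card G : ℝ)⁻¹ • (Pᴴ * P) := by
    rw [hPP, smul_smul, inv_mul_cancel₀ hc, one_smul]
  rw [this]
  exact (posSemidef_conjTranspose_mul_self P).smul (by positivity)

end Weyl

/-! ### Stabilizer states as averages over isotropic subgroups -/

section Stabilizer

variable {d n : ℕ} [NeZero d]

local notation "χ" => (ZMod.stdAddChar : AddChar (ZMod d) ℂ)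

lemma pauli_pow (h2 : (2 : ZMod d)⁻¹ + 2⁻¹ = 1) (c : ZMod d)
    (x : (Fin n → ZMod d) × (Fin n → ZMod d)) (k : ℕ) :
    pauli c x ^ k = pauli ((k : ZMod d) * c) ((k : ZMod d) • x) := by
  induction k with
  | zero => simp [pauli_zero]
  | succ k ih =>
    rw [pow_succ, ih, pauli_mul _ _ _ _ h2]
    congr 1
    · simp only [Prod.smul_fst, Prod.smul_snd, smul_dotProduct, dotProduct_smul]
      push_cast
      ring
    · rw [Nat.cast_succ, add_smul, one_smul]

lemma sum_range_natCast {E : Type*} [AddCommMonoid E] (f : ZMod d → E) :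
    ∑ k ∈ Finset.range d, f k = ∑ a, f a :=
  Finset.sum_nbij' (fun k => (k : ZMod d)) ZMod.val (fun _ _ => Finset.mem_univ _)
    (fun a _ => Finset.mem_range.2 (ZMod.val_lt a))
    (fun _ hk => ZMod.val_cast_of_lt (Finset.mem_range.1 hk)) (fun a _ => ZMod.natCast_zmod_val a)
    (fun _ _ => rfl)

/-- Linear combinations of the labels `x i`. -/
def labelSum {r : ℕ} (x : Fin r → (Fin n → ZMod d) × (Fin n → ZMod d)) :
    (Fin r → ZMod d) →+ (Fin n → ZMod d) × (Fin n → ZMod d) where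
  toFun a := ∑ i, a i • x i
  map_zero' := by simp
  map_add' a b := by simp [add_smul, Finset.sum_add_distrib]

lemma labelSum_apply {r : ℕ} (x : Fin r → (Fin n → ZMod d) × (Fin n → ZMod d))
    (a : Fin r → ZMod d) : labelSum x a = ∑ i, a i • x i := rfl

lemma isIsotropic_labelSum {r : ℕ} {x : Fin r → (Fin n → ZMod d) × (Fin n → ZMod d)}
    (hx : ∀ i j, (x i).1 ⬝ᵥ (x j).2 = (x j).1 ⬝ᵥ (x i).2) : IsIsotropic (labelSum x) := by
  intro a b
  simp only [labelSum_apply, Prod.fst_sum, Prod.snd_sum, sum_dotProduct, dotProduct_sum,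
    Prod.smul_fst, Prod.smul_snd, smul_dotProduct, dotProduct_smul, smul_eq_mul, Finset.mul_sum]
  rw [Finset.sum_comm]
  refine Finset.sum_congr rfl fun i _ => Finset.sum_congr rfl fun j _ => ?_
  rw [hx j i, mul_left_comm]

/-- The product of the projections onto the joint eigenspaces of commuting Pauli operators is an
average of a representation by Pauli operators. -/
lemma prod_average_pauli (h2 : (2 : ZMod d)⁻¹ + 2⁻¹ = 1) {r : ℕ} (c : Fin r → ZMod d)
    {x : Fin r → (Fin n → ZMod d) × (Fin n → ZMod d)}
    (hx : ∀ i j, (x i).1 ⬝ᵥ (x j).2 = (x j).1 ⬝ᵥ (x i).2) :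
    (List.ofFn fun i => (d : ℂ)⁻¹ • ∑ k ∈ Finset.range d, pauli (c i) (x i) ^ k).prod =
      ((d : ℂ)⁻¹ ^ r) • ∑ a : Fin r → ZMod d, pauli (∑ i, a i * c i) (labelSum x a) := by
  induction r with
  | zero => simp [labelSum_apply, pauli_zero]
  | succ r ih =>
    rw [List.ofFn_succ, List.prod_cons, ih _ fun i j => hx i.succ j.succ, smul_mul_smul_comm,
      ← pow_succ', ← (Fin.consEquiv fun _ => ZMod d).sum_comp, Fintype.sum_prod_type]
    congr 1
    simp only [pauli_pow h2]
    rw [sum_range_natCast fun k => pauli (k * c 0) (k • x 0), Finset.sum_mul_sum]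
    refine Finset.sum_congr rfl fun k _ => Finset.sum_congr rfl fun a _ => ?_
    rw [pauli_mul _ _ _ _ h2]
    -- Orthogonality of `k • x 0` to the span of the remaining labels kills the phase of the
    -- product.
    have h := isIsotropic_labelSum hx (Fin.cons k 0) (Fin.cons 0 a)
    simp only [labelSum_apply, Fin.sum_univ_succ, Fin.cons_zero, Fin.cons_succ, zero_smul,
      Pi.zero_apply, Finset.sum_const_zero, add_zero, zero_add] at h
    congr 1
    · simp only [labelSum_apply, Fin.consEquiv_apply, Fin.sum_univ_succ, Fin.cons_zero,
        Fin.cons_succ, h]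
      ring
    · simp only [labelSum_apply, Fin.consEquiv_apply, Fin.sum_univ_succ, Fin.cons_zero,
        Fin.cons_succ]

/-! ### The beam splitter channel -/

/-- The beam splitter permutes basis vectors by a rotation of determinant `s² + t² = 1`; the inverse
rotation appears here. -/
lemma beamSplitter_apply {s t : ZMod d} (hst : s ^ 2 + t ^ 2 = 1) (x y : Basis d n × Basis d n) :
    beamSplitter s t x y =
      if y = (s • x.1 - t • x.2, t • x.1 + s • x.2) then 1 else 0 := by
  obtain ⟨k, b⟩ := x
  obtain ⟨i, j⟩ := y
  have h : (s • i + t • j = k ∧ -t • i + s • j = b) ↔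
      (i, j) = (s • k - t • b, t • k + s • b) := by
    rw [Prod.mk.injEq]
    constructor
    · rintro ⟨rfl, rfl⟩
      constructor <;> ext m <;>
        simp only [Pi.add_apply, Pi.sub_apply, Pi.smul_apply, smul_eq_mul]
      · linear_combination (-i m) * hst
      · linear_combination (-j m) * hst
    · rintro ⟨rfl, rfl⟩
      constructor <;> ext m <;>
        simp only [Pi.add_apply, Pi.sub_apply, Pi.smul_apply, smul_eq_mul]
      · linear_combination (k m) * hst
      · linear_combination (b m) * hst
  simp only [beamSplitter, Matrix.sum_apply, kroneckerMap_apply]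
  rw [Finset.sum_eq_single i, Finset.sum_eq_single j]
  · simp only [single_apply, and_true, ← ite_and, mul_ite, mul_one, mul_zero]
    exact if_congr (and_comm.trans h) rfl rfl
  · intro j' _ hj'
    simp [single_apply, hj']
  · simp
  · intro i' _ hi'
    simp [single_apply, hi']
  · simp

lemma beamSplitterChannel_apply {s t : ZMod d} (hst : s ^ 2 + t ^ 2 = 1)
    (σ ρ : Matrix (Basis d n) (Basis d n) ℂ) (k k' : Basis d n) :
    beamSplitterChannel s t σ ρ k k' =
      ∑ b : Basis d n, ρ (s • k - t • b) (s • k' - t • b) * σ (t • k + s • b) (t • k' + s • b) := by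
  simp only [beamSplitterChannel, LinearMap.coe_mk, AddHom.coe_mk, ptraceRight, of_apply]
  refine Finset.sum_congr rfl fun b _ => ?_
  simp [mul_apply, beamSplitter_apply hst, conjTranspose_apply]

lemma beamSplitterChannel_add {s t : ZMod d} (hst : s ^ 2 + t ^ 2 = 1)
    (σ σ' : Matrix (Basis d n) (Basis d n) ℂ) :
    beamSplitterChannel s t (σ + σ') = beamSplitterChannel s t σ + beamSplitterChannel s t σ' := by
  ext ρ k k'
  simp [beamSplitterChannel_apply hst, mul_add, Finset.sum_add_distrib]

lemma beamSplitterChannel_smul {s t : ZMod d} (hst : s ^ 2 + t ^ 2 = 1) (c : ℂ)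
    (σ : Matrix (Basis d n) (Basis d n) ℂ) :
    beamSplitterChannel s t (c • σ) = c • beamSplitterChannel s t σ := by
  ext ρ k k'
  simp [beamSplitterChannel_apply hst, mul_left_comm, Finset.mul_sum]

lemma beamSplitterChannel_sum {ι : Type*} [Fintype ι] {s t : ZMod d} (hst : s ^ 2 + t ^ 2 = 1)
    (σ : ι → Matrix (Basis d n) (Basis d n) ℂ) (ρ : Matrix (Basis d n) (Basis d n) ℂ) :
    beamSplitterChannel s t (∑ i, σ i) ρ = ∑ i, beamSplitterChannel s t (σ i) ρ := by
  ext k k'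
  simp only [beamSplitterChannel_apply hst, Matrix.sum_apply, Finset.mul_sum]
  exact Finset.sum_comm

end Stabilizer

/-! ### Measure-and-prepare form of the channel -/

section Prime

variable {d n : ℕ} [Fact d.Prime]

local notation "χ" => (ZMod.stdAddChar : AddChar (ZMod d) ℂ)

/-- The beam splitter channel with a Pauli operator in the environment measures one Weyl operator and
outputs another one. -/
lemma beamSplitterChannel_pauli {s t : ZMod d} (hst : s ^ 2 + t ^ 2 = 1) (ht : t ≠ 0)
    (h2 : (2 : ZMod d)⁻¹ + 2⁻¹ = 1) (c : ZMod d) (v : (Fin n → ZMod d) × (Fin n → ZMod d))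
    (ρ : Matrix (Basis d n) (Basis d n) ℂ) :
    beamSplitterChannel s t (pauli c v) ρ =
      (ρ * pauli 0 (-(s * t⁻¹) • v)).trace • pauli c (t⁻¹ • v) := by
  obtain ⟨p, q⟩ := v
  ext k k'
  -- The condition does not involve the traced variable `b`, so the output is supported on a single
  -- shift, by `t⁻¹ • q`.
  have hcond : ∀ b : Basis d n, t • k + s • b = t • k' + s • b + q ↔ k = k' + t⁻¹ • q := by
    intro b
    rw [add_right_comm, add_left_inj, ← (smul_right_injective _ ht).eq_iff (a := k), smul_add,
      smul_inv_smul₀ ht]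
  rw [beamSplitterChannel_apply hst, Matrix.smul_apply, smul_eq_mul, pauli_apply]
  simp only [pauli_apply, hcond, Prod.smul_mk]
  by_cases hk : k = k' + t⁻¹ • q
  · simp only [if_pos hk]
    -- Substituting `s • k - t • b` for `b` turns the partial trace into a trace against `ρ`.
    let e : Basis d n ≃ Basis d n :=
      { toFun := fun b => s • k - t • b
        invFun := fun i => t⁻¹ • (s • k - i)
        left_inv := fun b => by simp [smul_smul, ht]
        right_inv := fun i => by simp [smul_smul, ht] }
    simp only [trace, diag_apply, mul_apply]
    rw [Finset.sum_mul]
    refine Fintype.sum_equiv e _ _ fun b => ?_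
    have he : s • k' - t • b = e b + (-(s * t⁻¹)) • q := by
      simp only [e, Equiv.coe_fn_mk, hk, smul_add, smul_smul, neg_smul]
      abel
    rw [Finset.sum_eq_single (s • k' - t • b)]
    · rw [pauli_apply, if_pos he, mul_assoc, ← AddChar.map_add_eq_mul, he]
      -- The phases split into a measured and a prepared part because `t = t⁻¹ - s² t⁻¹`.
      have hphase : c - 2⁻¹ * p ⬝ᵥ q + p ⬝ᵥ (t • k + s • b) =
          0 - 2⁻¹ * (-(s * t⁻¹) • p) ⬝ᵥ (-(s * t⁻¹) • q) +
            (-(s * t⁻¹) • p) ⬝ᵥ (e b + -(s * t⁻¹) • q) +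
          (c - 2⁻¹ * (t⁻¹ • p) ⬝ᵥ (t⁻¹ • q) + (t⁻¹ • p) ⬝ᵥ k) := by
        simp only [e, Equiv.coe_fn_mk, smul_dotProduct, dotProduct_smul, dotProduct_add,
          dotProduct_sub, smul_eq_mul]
        have h1 : t * t⁻¹ = 1 := mul_inv_cancel₀ ht
        linear_combination (p ⬝ᵥ k) * (t⁻¹ * hst - t * h1) - (p ⬝ᵥ b) * s * h1 +
          (p ⬝ᵥ q) * (s ^ 2 * t⁻¹ ^ 2 * h2 - 2⁻¹ * t⁻¹ ^ 2 * hst + 2⁻¹ * (t⁻¹ * t + 1) * h1)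
      rw [hphase]
      rfl
    · intro j _ hj
      rw [pauli_apply, if_neg (by rwa [he] at hj), mul_zero]
    · simp
  · simp [hk]

/-- Orthogonality of characters of `(ZMod d)^r`; a character is trivial iff it is trivial on the
standard basis. -/
lemma sum_stdAddChar_dotProduct {r : ℕ} (a : Fin r → ZMod d) :
    ∑ b : Fin r → ZMod d, χ (∑ i, b i * a i) = if a = 0 then (d : ℂ) ^ r else 0 := by
  let f : (Fin r → ZMod d) →+ ZMod d :=
    { toFun := fun b => ∑ i, b i * a i
      map_zero' := by simp
      map_add' := fun b b' => by simp [add_mul, Finset.sum_add_distrib] }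
  have h := AddChar.sum_eq_ite ((ZMod.stdAddChar : AddChar (ZMod d) ℂ).compAddMonoidHom f)
  have h0 : (ZMod.stdAddChar : AddChar (ZMod d) ℂ).compAddMonoidHom f = 0 ↔ a = 0 := by
    constructor
    · intro h
      ext i
      have hi := DFunLike.congr_fun h (Pi.single i 1)
      rw [AddChar.compAddMonoidHom_apply, AddChar.zero_apply, ← AddChar.map_zero_eq_one χ] at hi
      have := ZMod.injective_stdAddChar hi
      simpa [f, Pi.single_apply] using this
    · rintro rfl
      ext b
      simp [f]
  simp only [h0] at h
  simpa [f, ZMod.card] using h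

lemma pauli_add_left (c e : ZMod d) (x : (Fin n → ZMod d) × (Fin n → ZMod d)) :
    pauli (c + e) x = χ e • pauli c x := by
  rw [pauli, pauli, smul_smul, ← AddChar.map_add_eq_mul, add_comm]

/-- Parseval's identity: it trades the sum over group elements for a sum over measurement outcomes.
-/
lemma sum_mul_sum_of_orthogonal {ι κ : Type*} [Fintype ι] [DecidableEq ι] [Fintype κ]
    {F G : κ → ι → ℂ} {D : ℂ} (hD : D ≠ 0)
    (h : ∀ a a', ∑ b, F b a * G b a' = if a = a' then D else 0) (T V : ι → ℂ) :
    ∑ b, (∑ a, F b a * T a) * (D⁻¹ * ∑ a', G b a' * V a') = ∑ a, T a * V a := by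
  have hb : ∀ b, (∑ a, F b a * T a) * (D⁻¹ * ∑ a', G b a' * V a') =
      ∑ a, ∑ a', F b a * G b a' * (D⁻¹ * (T a * V a')) := fun b => by
    rw [Finset.mul_sum, Finset.sum_mul_sum]
    exact Finset.sum_congr rfl fun a _ => Finset.sum_congr rfl fun a' _ => by ring
  rw [Finset.sum_congr rfl fun b _ => hb b, Finset.sum_comm_cycle, Finset.sum_comm_cycle]
  simp only [← Finset.sum_mul, h]
  simp [hD]

/-- With an average of commuting Pauli operators in the environment, the beam splitter channel is a
measurement of commuting Weyl operators followed by a preparation. -/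
lemma entanglementBreaking_sum_pauli (h2 : (2 : ZMod d)⁻¹ + 2⁻¹ = 1) {s t : ZMod d}
    (hst : s ^ 2 + t ^ 2 = 1) (ht : t ≠ 0) {r : ℕ} (c : (Fin r → ZMod d) →+ ZMod d)
    {v : (Fin r → ZMod d) →+ (Fin n → ZMod d) × (Fin n → ZMod d)} (hv : IsIsotropic v) :
    EntanglementBreaking (beamSplitterChannel s t (∑ a, pauli (c a) (v a))) := by
  let f : (Fin r → ZMod d) → (Fin r → ZMod d) →+ ZMod d := fun b =>
    { toFun := fun a => ∑ i, b i * a i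
      map_zero' := by simp
      map_add' := fun a a' => by simp [mul_add, Finset.sum_add_distrib] }
  let w : ZMod d → (Fin r → ZMod d) →+ (Fin n → ZMod d) × (Fin n → ZMod d) := fun u =>
    { toFun := fun a => u • v a
      map_zero' := by simp
      map_add' := fun a a' => by simp }
  have hw : ∀ u, IsIsotropic (w u) := fun u a b => by
    change (u • v a).1 ⬝ᵥ (u • v b).2 = (u • v b).1 ⬝ᵥ (u • v a).2
    simp only [Prod.smul_fst, Prod.smul_snd, smul_dotProduct, dotProduct_smul, hv a b]
  have hd : (0 : ℝ) ≤ ((d : ℝ) ^ r)⁻¹ := by positivity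
  have hd' : (d : ℂ) ^ r ≠ 0 := pow_ne_zero _ (Nat.cast_ne_zero.2 (NeZero.ne d))
  -- The outcome `b` is a character. Measurement and preparation are twisted by opposite characters
  -- so that orthogonality pairs equal group elements; the normalization `d^{-r}` is put into the
  -- preparation.
  refine ⟨Fin r → ZMod d, inferInstance, fun b => ∑ a, pauli (f b a) (w (-(s * t⁻¹)) a),
    fun b => ((d : ℝ) ^ r)⁻¹ • ∑ a, pauli ((c - f b) a) (w t⁻¹ a),
    fun b => posSemidef_sum_pauli h2 _ (hw _),
    fun b => (posSemidef_sum_pauli h2 _ (hw _)).smul hd, fun ρ => ?_⟩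
  have hM : ∀ b a, pauli (f b a) (w (-(s * t⁻¹)) a) =
      χ (f b a) • pauli 0 (-(s * t⁻¹) • v a) := fun b a => by
    rw [← pauli_add_left, zero_add]
    rfl
  have hτ : ∀ b a, pauli ((c - f b) a) (w t⁻¹ a) = χ (-f b a) • pauli (c a) (t⁻¹ • v a) :=
    fun b a => by
      rw [← pauli_add_left, AddMonoidHom.sub_apply, sub_eq_add_neg]
      rfl
  have horth : ∀ a a', ∑ b, χ (f b a) * χ (-f b a') = if a = a' then (d : ℂ) ^ r else 0 := by
    intro a a'
    have := sum_stdAddChar_dotProduct (a - a')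
    simp only [sub_eq_zero] at this
    rw [← this]
    refine Finset.sum_congr rfl fun b _ => ?_
    rw [← AddChar.map_add_eq_mul, ← sub_eq_add_neg, ← map_sub]
    rfl
  rw [beamSplitterChannel_sum hst]
  simp only [beamSplitterChannel_pauli hst ht h2, hM, hτ]
  ext k k'
  simp only [Matrix.sum_apply, Matrix.smul_apply, Matrix.mul_sum, Matrix.mul_smul, trace_sum,
    trace_smul, smul_eq_mul, Complex.real_smul]
  push_cast
  exact (sum_mul_sum_of_orthogonal hd' horth _ _).symm

lemma entanglementBreaking_of_isStabilizerState (hd : Odd d) {s t : ZMod d}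
    (hst : s ^ 2 + t ^ 2 = 1) (ht : t ≠ 0) {σ : Matrix (Basis d n) (Basis d n) ℂ}
    (hσ : IsStabilizerState σ) : EntanglementBreaking (beamSplitterChannel s t σ) := by
  have h20 : (2 : ZMod d) ≠ 0 := by
    intro h
    have h' : ((2 : ℕ) : ZMod d) = 0 := by exact_mod_cast h
    rw [ZMod.natCast_eq_zero_iff] at h'
    have := (Nat.prime_dvd_prime_iff_eq Fact.out Nat.prime_two).1 h'
    subst this
    exact absurd hd (by decide)
  have h2 : (2 : ZMod d)⁻¹ + 2⁻¹ = 1 := by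
    rw [← two_mul, mul_inv_cancel₀ h20]
  obtain ⟨r, c, x, -, -, hcomm, rfl⟩ := hσ
  have hx : ∀ i j, (x i).1 ⬝ᵥ (x j).2 = (x j).1 ⬝ᵥ (x i).2 := fun i j =>
    dotProduct_comm_of_commute h2 (hcomm i j)
  let f : (Fin r → ZMod d) →+ ZMod d :=
    { toFun := fun a => ∑ i, a i * c i
      map_zero' := by simp
      map_add' := fun a a' => by simp [add_mul, Finset.sum_add_distrib] }
  have h := (entanglementBreaking_sum_pauli h2 hst ht f (isIsotropic_labelSum hx)).smul
    (c := ((d : ℝ) ^ (n - r))⁻¹ * (d : ℝ)⁻¹ ^ r) (by positivity)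
  rw [← beamSplitterChannel_smul hst] at h
  rw [prod_average_pauli h2 c hx, smul_smul]
  have hcast : ((((d : ℝ) ^ (n - r))⁻¹ * (d : ℝ)⁻¹ ^ r : ℝ) : ℂ) =
      ((d : ℂ) ^ (n - r))⁻¹ * (d : ℂ)⁻¹ ^ r := by
    push_cast
    rfl
  rw [hcast] at h
  exact h

/-- The channel is linear in `σ`, so the environments that give entanglement-breaking maps form a
convex set. -/
lemma entanglementBreaking_of_mem_convexHull (hd : Odd d) {s t : ZMod d}
    (hst : s ^ 2 + t ^ 2 = 1) (ht : t ≠ 0) {σ : Matrix (Basis d n) (Basis d n) ℂ}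
    (hσ : σ ∈ convexHull ℝ {τ : Matrix (Basis d n) (Basis d n) ℂ | IsStabilizerState τ}) :
    EntanglementBreaking (beamSplitterChannel s t σ) := by
  refine convexHull_min (t := {σ | EntanglementBreaking (beamSplitterChannel s t σ)})
    (fun τ hτ => entanglementBreaking_of_isStabilizerState hd hst ht hτ) ?_ hσ
  intro σ₁ h₁ σ₂ h₂ a b ha hb _
  have h := (EntanglementBreaking.smul ha h₁).add (EntanglementBreaking.smul hb h₂)
  rw [← beamSplitterChannel_smul hst, ← beamSplitterChannel_smul hst,
    ← beamSplitterChannel_add hst] at h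
  exact h

end Prime

end DiscreteBeamSplitter

open DiscreteBeamSplitter in
theorem theorem2 {d : ℕ} [Fact d.Prime] (hd : Odd d) (n : ℕ) (s t : ZMod d)
    (hst : s ^ 2 + t ^ 2 = 1)
    (hs0 : s ^ 2 ≠ 0) (hs1 : s ^ 2 ≠ 1) (ht0 : t ^ 2 ≠ 0) (ht1 : t ^ 2 ≠ 1)
    (σ : Matrix (Basis d n) (Basis d n) ℂ)
    (hσ : σ ∈ convexHull ℝ {τ : Matrix (Basis d n) (Basis d n) ℂ | IsStabilizerState τ}) :
    HasQuantumCapacity (beamSplitterChannel s t σ) 0 ∧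
      ∀ N : ℕ, ∀ x ∈ coherentInfoValues (tensorPower (beamSplitterChannel s t σ) N), x ≤ 0 := by
  have h := entanglementBreaking_of_mem_convexHull hd hst (pow_ne_zero_iff two_ne_zero |>.1 ht0) hσ
  refine ⟨h.hasQuantumCapacity_zero, ?_⟩
  rintro N _ ⟨ρ, -, r, Ψ, hΨ, rfl⟩
  exact (h.tensorPower N).coherentInfo_nonpos hΨ
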